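/- Let $d,m\ge 0$ be integers and let $L:\mathbb{C}^d\times\mathbb{C}^d\to\mathbb{C}$ be a bilinear function. For $\mathbf A=(\mathbf a_1,\dots,\mathbf a_m)\in(\mathbb{C}^d)^m$ and $\mathbf x\in\mathbb{C}^d$ put $L_{\mathbf A}(\mathbf x)=(L(\mathbf a_1,\mathbf x),\dots,L(\mathbf a_m,\mathbf x))\in\mathbb{C}^m$. An algebraic variety in $\mathbb{C}^n$ is the common zero locus of finitely many polynomials in $\mathbb{C}[x_1,\dots,x_n]$, not necessarily irreducible, and a real algebraic subset of $\mathbb{R}^n$ is the common zero locus of finitely many polynomials in $\mathbb{R}[x_1,\dots,x_n]$. For $S\subset\mathbb{C}^n$, $\dim S$ denotes the Krull dimension of $\mathbb{C}[x_1,\dots,x_n]/I(S)$, where $I(S)$ is the ideal of the polynomials vanishing on $S$; for $S\subset\mathbb{R}^n$, $\dim_{\mathbb{R}}S$ is the Krull dimension of $\mathbb{R}[x_1,\dots,x_n]/I(S)$, with $I(S)$ formed in $\mathbb{R}[x_1,\dots,x_n]$. The empty set has dimension $-\infty$. For $S\subset\mathbb{C}^n$ put $S_{\mathbb{R}}=S\cap\mathbb{R}^n$.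 Let $W\subset\mathbb{C}^d$ be the common zero locus of finitely many homogeneous polynomials, and let $V_1,\dots,V_m\subset\mathbb{C}^d$ be nonempty algebraic varieties. Assume that each $V_j$ is admissible with respect to the linear functions $L(\cdot,\mathbf x)$, $\mathbf x\in W\setminus\{0\}$, that is, $$\dim\bigl(V_j\cap\{\mathbf a\in\mathbb{C}^d: L(\mathbf a,\mathbf x)=0\}\bigr)<\dim V_j\qquad\text{for every } \mathbf x\in W\setminus\{0\}.$$ Let $V=V_1\times\cdots\times V_m\subset(\mathbb{C}^d)^m$ and suppose that $\dim_{\mathbb{R}}(V_{\mathbb{R}})=\dim V$ and $m\ge\dim W$. Then there is a real algebraic subset $\tilde Z\subset V_{\mathbb{R}}$ with $\dim_{\mathbb{R}}\tilde Z<\dim_{\mathbb{R}}V_{\mathbb{R}}$ such that, for every $\mathbf A\in V_{\mathbb{R}}\setminus\tilde Z$ and every $\mathbf x\in W$, $L_{\mathbf A}(\mathbf x)=0$ implies $\mathbf x=0$. -/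

import Mathlib

noncomputable section

namespace OptimalSampling

/-- A subset of `k^σ` is algebraic if it is the common zero locus of finitely many polynomials
over `k`. -/
def IsAlgebraicSet {k σ : Type*} [Field k] (S : Set (σ → k)) : Prop :=
  ∃ P : Finset (MvPolynomial σ k), S = {x | ∀ p ∈ P, MvPolynomial.eval x p = 0}

/-- A subset of `k^σ` that is the common zero locus of finitely many homogeneous polynomials
over `k` (possibly of different degrees). -/
def IsHomogeneousAlgebraicSet {k σ : Type*} [Field k] (S : Set (σ → k)) : Prop :=
  ∃ P : Finset (MvPolynomial σ k), (∀ p ∈ P, ∃ n : ℕ, p.IsHomogeneous n) ∧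
    S = {x | ∀ p ∈ P, MvPolynomial.eval x p = 0}

/-- The dimension of `S ⊆ k^σ`: the Krull dimension of the ring `k[x] / I(S)` of polynomial
functions on `S`, where `I(S)` is the ideal of all polynomials over `k` vanishing on `S`.
For `k = ℂ` this is the dimension of an algebraic variety, for `k = ℝ` it is the real
dimension of a real algebraic set. The empty set has dimension `⊥`. -/
def dim {k σ : Type*} [Field k] (S : Set (σ → k)) : WithBot ℕ∞ :=
  ringKrullDim (MvPolynomial σ k ⧸ MvPolynomial.vanishingIdeal k S)

/-- The real points `S_ℝ = S ∩ ℝ^σ` of `S ⊆ ℂ^σ`, as a subset of `ℝ^σ`. -/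
def realPoints {σ : Type*} (S : Set (σ → ℂ)) : Set (σ → ℝ) :=
  {a | (fun i => (a i : ℂ)) ∈ S}

/-- `V` is admissible with respect to a set `F` of linear functions if every hyperplane section
`V ∩ {ℓ = 0}` with `ℓ ∈ F` has strictly smaller dimension than `V`. -/
def IsAdmissible {d : ℕ} (V : Set (Fin d → ℂ)) (F : Set ((Fin d → ℂ) →ₗ[ℂ] ℂ)) : Prop :=
  ∀ ℓ ∈ F, dim (V ∩ {a | ℓ a = 0}) < dim V

/-- The product `V₁ × ⋯ × V_m ⊆ (ℂ^d)^m`; the `j`-th vector of `A` is `i ↦ A (j, i)`. -/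
def productSet {m d : ℕ} (V : Fin m → Set (Fin d → ℂ)) : Set (Fin m × Fin d → ℂ) :=
  {A | ∀ j, (fun i => A (j, i)) ∈ V j}

/-- The sampling map `L_A(x) = (L(a₁, x), …, L(a_m, x))`. -/
def sample {m d : ℕ} (L : (Fin d → ℂ) →ₗ[ℂ] (Fin d → ℂ) →ₗ[ℂ] ℂ) (A : Fin m × Fin d → ℂ)
    (x : Fin d → ℂ) : Fin m → ℂ :=
  fun j => L (fun i => A (j, i)) x

end OptimalSampling

end

/-! Call `A` zero detecting if `L_A(x) = 0` implies `x = 0` on `W`. A Noether normalization shows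
that the dimension is additive on products and does not increase on passing to the points over a
subfield, so it suffices to find, over the algebraically closed field, a closed subset of `V` of
smaller dimension outside of which every `A` is zero detecting.

Split each `V_j` into irreducible pieces. A product of pieces has the dimension of `V` only if each
piece has the dimension of its `V_j`; admissibility then says that, for `x ∈ W \ {0}`, no such piece
lies in the hyperplane `L(·, x) = 0`. Hence a general point of the piece of `V_j` cuts every
component of `W` other than `{0}` down by one dimension, and after `m ≥ dim W` cuts the cone `W` is
reduced to the origin: the product contains a zero detecting `A`. Being zero detecting is an open
condition: by the Nullstellensatz some power of the variables lies in the ideal of the equations of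
`W` and `L_A(x) = 0`, and by Nakayama's lemma it remains so for all nearby `A`. So a polynomial
that is nonzero at a zero detecting point confines the others to a proper closed subset of the
irreducible product. -/

noncomputable section

namespace OptimalSampling

open MvPolynomial

section Integral

variable {R S : Type*} [CommRing R] [CommRing S] {f : R →+* S}

lemma ringKrullDim_le_of_isIntegral (hf : f.IsIntegral) : ringKrullDim S ≤ ringKrullDim R := by
  algebraize [f]
  exact Order.krullDim_le_of_strictMono (PrimeSpectrum.comap f) fun P Q hPQ =>
    Ideal.IsIntegral.comap_lt_comap (R := R) (show P.asIdeal < Q.asIdeal from hPQ)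

lemma ringKrullDim_le_of_isIntegral_of_injective (hf : f.IsIntegral)
    (hinj : Function.Injective f) : ringKrullDim R ≤ ringKrullDim S := by
  algebraize [f]
  have : FaithfulSMul R S := (faithfulSMul_iff_algebraMap_injective R S).2 hinj
  refine iSup_le fun l => ?_
  obtain ⟨Q, hQ⟩ := hf.comap_surjective hinj l.head
  have : Q.asIdeal.LiesOver l.head.asIdeal := ⟨by rw [← hQ]; rfl⟩
  obtain ⟨l', hl', -⟩ := Ideal.exists_ltSeries_of_hasGoingUp l Q.asIdeal
  rw [← hl']
  exact Order.LTSeries.length_le_krullDim l'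

lemma ringKrullDim_eq_of_isIntegral_of_injective (hf : f.IsIntegral)
    (hinj : Function.Injective f) : ringKrullDim R = ringKrullDim S :=
  (ringKrullDim_le_of_isIntegral_of_injective hf hinj).antisymm (ringKrullDim_le_of_isIntegral hf)

end Integral

section AlgebraicSet

variable {k σ : Type*} [Field k]

lemma isAlgebraicSet_setOf_forall_mem [Finite σ] (P : Set (MvPolynomial σ k)) :
    IsAlgebraicSet {x | ∀ p ∈ P, eval x p = 0} := by
  obtain ⟨Q, hQ⟩ := IsNoetherian.noetherian (Ideal.span P)
  refine ⟨Q, ?_⟩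
  change {x | ∀ p ∈ P, aeval x p = 0} = {x | ∀ p ∈ (Q : Set (MvPolynomial σ k)), aeval x p = 0}
  rw [← zeroLocus_span, ← zeroLocus_span, ← hQ]

lemma IsAlgebraicSet.inter [Finite σ] {S T : Set (σ → k)} (hS : IsAlgebraicSet S)
    (hT : IsAlgebraicSet T) : IsAlgebraicSet (S ∩ T) := by
  obtain ⟨P, rfl⟩ := hS
  obtain ⟨Q, rfl⟩ := hT
  convert isAlgebraicSet_setOf_forall_mem (P ∪ Q : Set (MvPolynomial σ k)) using 1
  ext x
  simp [or_imp, forall_and]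

lemma IsHomogeneousAlgebraicSet.isAlgebraicSet {S : Set (σ → k)}
    (hS : IsHomogeneousAlgebraicSet S) : IsAlgebraicSet S :=
  hS.imp fun _ h => h.2

lemma nonempty_of_isPrime_vanishingIdeal {S : Set (σ → k)} (hS : (vanishingIdeal k S).IsPrime) :
    S.Nonempty := by
  rw [Set.nonempty_iff_ne_empty]
  rintro rfl
  exact hS.ne_top vanishingIdeal_empty

lemma vanishingIdeal_ne_top {S : Set (σ → k)} (hS : S.Nonempty) : vanishingIdeal k S ≠ ⊤ := by
  obtain ⟨x, hx⟩ := hS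
  exact (Ideal.ne_top_iff_one _).2 fun h => by simpa using h x hx

lemma notMem_vanishingIdeal_iff {S : Set (σ → k)} {p : MvPolynomial σ k} :
    p ∉ vanishingIdeal k S ↔ ∃ x ∈ S, eval x p ≠ 0 := by
  simp [mem_vanishingIdeal_iff, aeval_eq_eval]

lemma exists_mem_forall_eval_ne_zero {ι : Type*} [Finite ι] {S : Set (σ → k)}
    (hS : (vanishingIdeal k S).IsPrime) {q : ι → MvPolynomial σ k}
    (hq : ∀ i, q i ∉ vanishingIdeal k S) : ∃ a ∈ S, ∀ i, eval a (q i) ≠ 0 := by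
  have := Fintype.ofFinite ι
  have hprod : ∏ i, q i ∉ vanishingIdeal k S := by
    rw [Ideal.IsPrime.prod_mem_iff]
    simpa using hq
  obtain ⟨a, ha, hprod⟩ := notMem_vanishingIdeal_iff.1 hprod
  rw [map_prod] at hprod
  exact ⟨a, ha, fun i => Finset.prod_ne_zero_iff.1 hprod i (Finset.mem_univ i)⟩

lemma IsAlgebraicSet.exists_eq_iUnion_isPrime [IsAlgClosed k] [Finite σ] {S : Set (σ → k)}
    (hS : IsAlgebraicSet S) :
    ∃ (n : ℕ) (C : Fin n → Set (σ → k)),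
      (∀ i, (vanishingIdeal k (C i)).IsPrime) ∧ S = ⋃ i, C i := by
  obtain ⟨P, rfl⟩ := hS
  let I : Ideal (MvPolynomial σ k) := Ideal.span P
  have hfin : Finite I.minimalPrimes := Ideal.finite_minimalPrimes_of_isNoetherianRing _ I
  obtain ⟨n, ⟨e⟩⟩ := Finite.exists_equiv_fin I.minimalPrimes
  refine ⟨n, fun i => zeroLocus k (e.symm i).1, fun i => ?_, ?_⟩
  · have hprime : (e.symm i).1.IsPrime := (e.symm i).2.1.1
    rwa [IsPrime.vanishingIdeal_zeroLocus]
  · change {x | ∀ p ∈ (P : Set (MvPolynomial σ k)), aeval x p = 0} = _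
    rw [← zeroLocus_span]
    refine Set.Subset.antisymm (fun x hx => ?_) (Set.iUnion_subset fun i =>
      zeroLocus_anti_mono (e.symm i).2.1.2)
    have hIx : I ≤ vanishingIdeal k {x} :=
      le_zeroLocus_iff_le_vanishingIdeal.1 (Set.singleton_subset_iff.2 hx)
    obtain ⟨Q, hQ, hQx⟩ := Ideal.exists_minimalPrimes_le hIx
    refine Set.mem_iUnion.2 ⟨e ⟨Q, hQ⟩, ?_⟩
    rw [Equiv.symm_apply_apply]
    exact fun p hp => hQx hp x rfl

end AlgebraicSet

section Noether

variable {k σ τ : Type*} [Field k]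

/-- The polynomial map `g : S → k^τ` is a Noether normalization of `S`: its image is Zariski dense
and every coordinate function on `S` is integral over the polynomials in `g`. Both conditions are
expressed through the points of `S`, so that they can be transported to products and to larger
fields without handling coordinate rings. -/
structure IsNoetherNormalization (S : Set (σ → k)) (g : τ → MvPolynomial σ k) : Prop where
  eq_zero_of_forall_mem : ∀ F : MvPolynomial τ k,
    (∀ x ∈ S, eval (fun t => eval x (g t)) F = 0) → F = 0
  exists_monic : ∀ i, ∃ r : Polynomial (MvPolynomial τ k), r.Monic ∧
    ∀ x ∈ S, r.eval₂ (eval fun t => eval x (g t)) (x i) = 0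

/-- The homomorphism from `k[τ]` to the coordinate ring of `S` that is dual to `g : S → k^τ`. -/
def coordinateRingHom (S : Set (σ → k)) (g : τ → MvPolynomial σ k) :
    MvPolynomial τ k →+* MvPolynomial σ k ⧸ vanishingIdeal k S :=
  (Ideal.Quotient.mk _).comp (bind₁ g).toRingHom

lemma coordinateRingHom_eq_zero_iff {S : Set (σ → k)} {g : τ → MvPolynomial σ k}
    {F : MvPolynomial τ k} :
    coordinateRingHom S g F = 0 ↔ ∀ x ∈ S, eval (fun t => eval x (g t)) F = 0 := by
  change Ideal.Quotient.mk _ (bind₁ g F) = 0 ↔ _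
  rw [Ideal.Quotient.eq_zero_iff_mem, mem_vanishingIdeal_iff]
  simp only [aeval_bind₁, aeval_eq_eval]

lemma eval₂_coordinateRingHom_mk_eq_zero_iff {S : Set (σ → k)} {g : τ → MvPolynomial σ k}
    {r : Polynomial (MvPolynomial τ k)} {p : MvPolynomial σ k} :
    r.eval₂ (coordinateRingHom S g) (Ideal.Quotient.mk _ p) = 0 ↔
      ∀ x ∈ S, r.eval₂ (eval fun t => eval x (g t)) (eval x p) = 0 := by
  rw [coordinateRingHom, ← Polynomial.hom_eval₂, Ideal.Quotient.eq_zero_iff_mem,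
    mem_vanishingIdeal_iff]
  refine forall₂_congr fun x _ => ?_
  have hcomp : (eval x).comp (bind₁ g).toRingHom = eval fun t => eval x (g t) := by
    ext <;> simp
  rw [aeval_eq_eval, Polynomial.hom_eval₂, hcomp]

namespace IsNoetherNormalization

variable {S : Set (σ → k)} {g : τ → MvPolynomial σ k}

lemma injective_coordinateRingHom (hg : IsNoetherNormalization S g) :
    Function.Injective (coordinateRingHom S g) :=
  (injective_iff_map_eq_zero _).2 fun F hF =>
    hg.eq_zero_of_forall_mem F (coordinateRingHom_eq_zero_iff.1 hF)

lemma isIntegral_coordinateRingHom (hg : IsNoetherNormalization S g) :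
    (coordinateRingHom S g).IsIntegral := by
  intro q
  obtain ⟨p, rfl⟩ := Ideal.Quotient.mk_surjective q
  induction p using MvPolynomial.induction_on with
  | C c =>
    have hC : Ideal.Quotient.mk (vanishingIdeal k S) (C c) = coordinateRingHom S g (C c) := by
      simp [coordinateRingHom]
    rw [hC]
    exact RingHom.isIntegralElem_map _
  | add p q hp hq => rw [map_add]; exact hp.add _ hq
  | mul_X p i hp =>
    obtain ⟨r, hr, hr0⟩ := hg.exists_monic i
    rw [map_mul]
    exact hp.mul _ ⟨r, hr, eval₂_coordinateRingHom_mk_eq_zero_iff.2 (by simpa using hr0)⟩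

lemma dim_eq [Finite τ] (hg : IsNoetherNormalization S g) : dim S = Nat.card τ := by
  rw [dim, ← ringKrullDim_eq_of_isIntegral_of_injective hg.isIntegral_coordinateRingHom
    hg.injective_coordinateRingHom]
  simp [ringKrullDim_eq_zero_of_field]

end IsNoetherNormalization

lemma exists_isNoetherNormalization [Finite σ] {S : Set (σ → k)} (hS : S.Nonempty) :
    ∃ (n : ℕ) (g : Fin n → MvPolynomial σ k), IsNoetherNormalization S g := by
  have : Nontrivial (MvPolynomial σ k ⧸ vanishingIdeal k S) :=
    Ideal.Quotient.nontrivial_iff.2 (vanishingIdeal_ne_top hS)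
  obtain ⟨n, f, hinj, hint⟩ :=
    exists_integral_inj_algHom_of_fg k (MvPolynomial σ k ⧸ vanishingIdeal k S)
  choose g hg using fun i => Ideal.Quotient.mk_surjective (f (X i))
  have hf : f.toRingHom = coordinateRingHom S g := by
    ext c
    · simpa [coordinateRingHom] using (Ideal.Quotient.mk_algebraMap k (vanishingIdeal k S) c).symm
    · simp [coordinateRingHom, hg]
  refine ⟨n, g, fun F hF => hinj ?_, fun i => ?_⟩
  · rw [map_zero]
    exact (DFunLike.congr_fun hf F).trans (coordinateRingHom_eq_zero_iff.2 hF)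
  · obtain ⟨r, hr, hr0⟩ := hint (Ideal.Quotient.mk _ (X i))
    rw [hf, eval₂_coordinateRingHom_mk_eq_zero_iff] at hr0
    exact ⟨r, hr, by simpa using hr0⟩

end Noether

section Dimension

variable {k σ : Type*} [Field k]

lemma dim_mono {S T : Set (σ → k)} (h : S ⊆ T) : dim S ≤ dim T :=
  ringKrullDim_le_of_surjective (Ideal.Quotient.factor (vanishingIdeal_anti_mono h))
    (Ideal.Quotient.factor_surjective _)

lemma dim_empty : dim (∅ : Set (σ → k)) = ⊥ := by
  have : Subsingleton (MvPolynomial σ k ⧸ vanishingIdeal k (∅ : Set (σ → k))) :=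
    Ideal.Quotient.subsingleton_iff.2 vanishingIdeal_empty
  exact ringKrullDim_eq_bot_of_subsingleton

lemma exists_dim_eq_natCast [Finite σ] {S : Set (σ → k)} (hS : S.Nonempty) :
    ∃ n : ℕ, dim S = n := by
  obtain ⟨n, g, hg⟩ := exists_isNoetherNormalization hS
  exact ⟨n, by simpa using hg.dim_eq⟩

lemma dim_singleton (x : σ → k) : dim {x} = 0 := by
  have hx : IsNoetherNormalization {x} (Empty.elim : Empty → MvPolynomial σ k) := by
    constructor
    · intro F hF
      obtain ⟨c, rfl⟩ := C_surjective Empty F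
      simpa using hF x rfl
    · intro i
      refine ⟨Polynomial.X - Polynomial.C (C (x i)), Polynomial.monic_X_sub_C _, ?_⟩
      simp
  simpa using hx.dim_eq

-- The prime at the bottom of a chain above `I(⋃ S i)` contains one of the `I(S i)`.
lemma dim_iUnion {ι : Type*} [Finite ι] (S : ι → Set (σ → k)) :
    dim (⋃ i, S i) = ⨆ i, dim (S i) := by
  refine le_antisymm ?_ (iSup_le fun i => dim_mono (Set.subset_iUnion S i))
  have := Fintype.ofFinite ι
  rw [dim, ringKrullDim_quotient]
  refine iSup_le fun l => ?_
  have hle : Finset.univ.inf (fun i => vanishingIdeal k (S i)) ≤ l.head.1.asIdeal := by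
    refine le_trans (b := vanishingIdeal k (⋃ i, S i)) (fun p hp x hx => ?_) l.head.2
    obtain ⟨i, hi⟩ := Set.mem_iUnion.1 hx
    exact (Submodule.mem_finsetInf.1 hp) i (Finset.mem_univ _) x hi
  obtain ⟨i, -, hi⟩ := (Ideal.IsPrime.inf_le' l.head.1.2).1 hle
  refine le_trans ?_ (le_iSup (fun i => dim (S i)) i)
  rw [dim, ringKrullDim_quotient]
  exact Order.LTSeries.length_le_krullDim
    (α := PrimeSpectrum.zeroLocus (vanishingIdeal k (S i) : Set (MvPolynomial σ k)))
    { length := l.length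
      toFun := fun j => ⟨(l j).1, hi.trans (show l.head.1 ≤ (l j).1 from l.head_le j)⟩
      step := fun j => l.step j }

lemma dim_iUnion_lt {ι : Type*} [Finite ι] {S : ι → Set (σ → k)} {n : WithBot ℕ∞} (hn : ⊥ < n)
    (hS : ∀ i, dim (S i) < n) : dim (⋃ i, S i) < n := by
  have := Fintype.ofFinite ι
  rw [dim_iUnion, ← Finset.sup_univ_eq_iSup, Finset.sup_lt_iff hn]
  exact fun i _ => hS i

lemma dim_lt_of_mem_vanishingIdeal [Finite σ] {S T : Set (σ → k)}
    (hT : (vanishingIdeal k T).IsPrime) (hST : S ⊆ T) {f : MvPolynomial σ k}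
    (hfS : f ∈ vanishingIdeal k S) (hfT : f ∉ vanishingIdeal k T) : dim S < dim T := by
  obtain ⟨n, hn⟩ := exists_dim_eq_natCast (nonempty_of_isPrime_vanishingIdeal hT)
  have hle : dim S + 1 ≤ dim T := by
    refine ringKrullDim_succ_le_of_surjective
      (Ideal.Quotient.factor (vanishingIdeal_anti_mono hST)) (Ideal.Quotient.factor_surjective _)
      (r := Ideal.Quotient.mk _ f) ?_ ?_
    · rwa [mem_nonZeroDivisors_iff_ne_zero, Ne, Ideal.Quotient.eq_zero_iff_mem]
    · simpa [Ideal.Quotient.eq_zero_iff_mem] using hfS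
  rw [hn] at hle ⊢
  exact ENat.WithBot.add_one_le_natCast_iff.1 hle

end Dimension

section SeparatelyPolynomial

variable {k ι : Type*} [Field k] {σ : ι → Type*}

/-- A function on a product of affine spaces that is polynomial in each of its arguments when all
the other arguments are fixed. -/
def IsSeparatelyPolynomial [DecidableEq ι] (Φ : (∀ j, σ j → k) → k) : Prop :=
  ∀ a j, ∃ p : MvPolynomial (σ j) k, ∀ z, eval z p = Φ (Function.update a j z)

lemma isSeparatelyPolynomial_eval [DecidableEq ι] {Ω : Type*} (b : Ω → Σ j, σ j)
    (F : MvPolynomial Ω k) :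
    IsSeparatelyPolynomial fun a => eval (fun ω => a (b ω).1 (b ω).2) F := by
  intro a j
  let u : ∀ j', σ j' → MvPolynomial (σ j) k := Function.update (fun j' i => C (a j' i)) j X
  refine ⟨aeval (fun ω => u (b ω).1 (b ω).2) F, fun z => ?_⟩
  rw [← aeval_eq_eval, ← AlgHom.comp_apply, comp_aeval, aeval_eq_eval]
  congr! 3 with ω
  rcases eq_or_ne (b ω).1 j with h | h
  · generalize b ω = c at h ⊢
    obtain ⟨_, i⟩ := c
    obtain rfl : _ = j := h
    simp [u]
  · simp [u, h]

namespace IsSeparatelyPolynomial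

variable [DecidableEq ι] [Finite ι] {Φ Ψ : (∀ j, σ j → k) → k}

lemma exists_mem_ne_zero_of_dense (hΦ : IsSeparatelyPolynomial Φ) {S : ∀ j, Set (σ j → k)}
    (hS : ∀ j, vanishingIdeal k (S j) = ⊥) {a : ∀ j, σ j → k} (ha : Φ a ≠ 0) :
    ∃ b, (∀ j, b j ∈ S j) ∧ Φ b ≠ 0 := by
  have := Fintype.ofFinite ι
  suffices h : ∀ s : Finset ι, ∃ b, (∀ j ∈ s, b j ∈ S j) ∧ Φ b ≠ 0 by
    simpa using h Finset.univ
  intro s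
  induction s using Finset.induction_on with
  | empty => exact ⟨a, by simp, ha⟩
  | insert j s hj ih =>
    obtain ⟨b, hb, hΦb⟩ := ih
    obtain ⟨p, hp⟩ := hΦ b j
    have hp0 : p ∉ vanishingIdeal k (S j) := by
      rw [hS j, Ideal.mem_bot]
      rintro rfl
      exact hΦb (by simpa using (hp (b j)).symm)
    obtain ⟨z, hz, hpz⟩ := notMem_vanishingIdeal_iff.1 hp0
    refine ⟨Function.update b j z, fun j' hj' => ?_, by rwa [← hp]⟩
    rcases eq_or_ne j' j with rfl | hne
    · simpa using hz
    · simpa [hne] using hb j' (Finset.mem_of_mem_insert_of_ne hj' hne)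

-- The coordinates of `a` and `b` are made equal one block at a time.
lemma exists_mem_ne_zero_of_isPrime (hΦ : IsSeparatelyPolynomial Φ)
    (hΨ : IsSeparatelyPolynomial Ψ) {S : ∀ j, Set (σ j → k)}
    (hS : ∀ j, (vanishingIdeal k (S j)).IsPrime) {a b : ∀ j, σ j → k} (ha : ∀ j, a j ∈ S j)
    (hb : ∀ j, b j ∈ S j) (hΦa : Φ a ≠ 0) (hΨb : Ψ b ≠ 0) :
    ∃ c, (∀ j, c j ∈ S j) ∧ Φ c ≠ 0 ∧ Ψ c ≠ 0 := by
  have := Fintype.ofFinite ι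
  suffices h : ∀ s : Finset ι, ∃ a b, (∀ j, a j ∈ S j) ∧ (∀ j, b j ∈ S j) ∧
      (∀ j ∈ s, a j = b j) ∧ Φ a ≠ 0 ∧ Ψ b ≠ 0 by
    obtain ⟨a, b, ha, -, hab, hΦa, hΨb⟩ := h Finset.univ
    obtain rfl : a = b := funext fun j => hab j (Finset.mem_univ j)
    exact ⟨a, ha, hΦa, hΨb⟩
  intro s
  induction s using Finset.induction_on with
  | empty => exact ⟨a, b, ha, hb, by simp, hΦa, hΨb⟩
  | insert j s hj ih =>
    obtain ⟨a, b, ha, hb, hab, hΦa, hΨb⟩ := ih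
    obtain ⟨p, hp⟩ := hΦ a j
    obtain ⟨q, hq⟩ := hΨ b j
    have hpS : p ∉ vanishingIdeal k (S j) :=
      notMem_vanishingIdeal_iff.2 ⟨a j, ha j, by simpa [hp] using hΦa⟩
    have hqS : q ∉ vanishingIdeal k (S j) :=
      notMem_vanishingIdeal_iff.2 ⟨b j, hb j, by simpa [hq] using hΨb⟩
    obtain ⟨z, hz, hpq⟩ := notMem_vanishingIdeal_iff.1 ((hS j).mul_notMem hpS hqS)
    rw [map_mul, hp, hq] at hpq
    have hmem : ∀ c : ∀ j, σ j → k, (∀ j, c j ∈ S j) → ∀ j', Function.update c j z j' ∈ S j' :=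
      fun c hc => (Function.forall_update_iff c fun j' y => y ∈ S j').2 ⟨hz, fun j' _ => hc j'⟩
    refine ⟨Function.update a j z, Function.update b j z, hmem a ha, hmem b hb, fun j' hj' => ?_,
      left_ne_zero_of_mul hpq, right_ne_zero_of_mul hpq⟩
    rcases eq_or_ne j' j with rfl | hne
    · simp
    · simpa [hne] using hab j' (Finset.mem_of_mem_insert_of_ne hj' hne)

end IsSeparatelyPolynomial

end SeparatelyPolynomial

section BlockProduct

variable {k ι σ : Type*}

/-- The product of the sets `V j ⊆ k^σ` as a subset of `k^(ι × σ)`. Over `ℂ` with the index types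
`Fin m` and `Fin d` this is `productSet V`. -/
def blockProduct (V : ι → Set (σ → k)) : Set (ι × σ → k) :=
  {A | ∀ j, (fun i => A (j, i)) ∈ V j}

lemma blockProduct_mono {S V : ι → Set (σ → k)} (h : ∀ j, S j ⊆ V j) :
    blockProduct S ⊆ blockProduct V :=
  fun _ hA j => h j (hA j)

lemma blockProduct_iUnion {α : ι → Type*} (C : ∀ j, α j → Set (σ → k)) :
    blockProduct (fun j => ⋃ i, C j i) = ⋃ c : ∀ j, α j, blockProduct fun j => C j (c j) := by
  ext A
  simp [blockProduct, Classical.skolem]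

variable [Field k]

lemma isAlgebraicSet_blockProduct [Finite ι] [Finite σ] {V : ι → Set (σ → k)}
    (hV : ∀ j, IsAlgebraicSet (V j)) : IsAlgebraicSet (blockProduct V) := by
  choose P hP using hV
  convert isAlgebraicSet_setOf_forall_mem
    {q | ∃ j, ∃ p ∈ P j, rename (Prod.mk j) p = q} using 1
  ext A
  simp only [blockProduct, hP]
  constructor
  · rintro h _ ⟨j, p, hp, rfl⟩
    rw [eval_rename]
    exact h j p hp
  · intro h j p hp
    simpa only [eval_rename, Function.comp_def] using h _ ⟨j, p, hp, rfl⟩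

lemma isPrime_vanishingIdeal_blockProduct [Finite ι] {S : ι → Set (σ → k)}
    (hS : ∀ j, (vanishingIdeal k (S j)).IsPrime) :
    (vanishingIdeal k (blockProduct S)).IsPrime := by
  classical
  have hne : (blockProduct S).Nonempty := by
    choose a ha using fun j => nonempty_of_isPrime_vanishingIdeal (hS j)
    exact ⟨fun p => a p.1 p.2, ha⟩
  refine Ideal.isPrime_iff.2 ⟨vanishingIdeal_ne_top hne, fun {F G} hFG => ?_⟩
  by_contra! h
  obtain ⟨A, hA, hFA⟩ := notMem_vanishingIdeal_iff.1 h.1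
  obtain ⟨B, hB, hGB⟩ := notMem_vanishingIdeal_iff.1 h.2
  have hpoly := isSeparatelyPolynomial_eval (k := k) fun p : ι × σ => (⟨p.1, p.2⟩ : Σ _ : ι, σ)
  obtain ⟨c, hc, hFc, hGc⟩ := (hpoly F).exists_mem_ne_zero_of_isPrime (hpoly G) hS hA hB hFA hGB
  refine mul_ne_zero hFc hGc ?_
  rw [← map_mul]
  exact hFG (fun p => c p.1 p.2) hc

lemma isNoetherNormalization_blockProduct [Infinite k] [Finite ι] {S : ι → Set (σ → k)}
    {τ : ι → Type*} {g : ∀ j, τ j → MvPolynomial σ k}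
    (hg : ∀ j, IsNoetherNormalization (S j) (g j)) :
    IsNoetherNormalization (blockProduct S)
      fun t : Σ j, τ j => rename (Prod.mk t.1) (g t.1 t.2) := by
  classical
  constructor
  · intro F hF
    by_contra hF0
    obtain ⟨y, hy⟩ : ∃ y, eval y F ≠ 0 := by
      contrapose! hF0
      exact MvPolynomial.funext (by simpa using hF0)
    have hdense : ∀ j, vanishingIdeal k ((fun a t => eval a (g j t)) '' S j) = ⊥ := fun j =>
      eq_bot_iff.2 fun H hH => (hg j).eq_zero_of_forall_mem H fun a ha => hH _ ⟨a, ha, rfl⟩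
    obtain ⟨b, hb, hFb⟩ := (isSeparatelyPolynomial_eval id F).exists_mem_ne_zero_of_dense hdense
      (a := fun j t => y ⟨j, t⟩) hy
    choose a ha hab using hb
    refine hFb ?_
    simpa [eval_rename, Function.comp_def, ← hab] using hF (fun p => a p.1 p.2) ha
  · rintro ⟨j, i⟩
    obtain ⟨r, hr, hr0⟩ := (hg j).exists_monic i
    refine ⟨r.map (rename (Sigma.mk j)).toRingHom, hr.map _, fun A hA => ?_⟩
    rw [Polynomial.eval₂_map]
    convert hr0 _ (hA j) using 2
    ext t <;> simp [eval_rename, Function.comp_def]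

lemma dim_blockProduct [Infinite k] [Fintype ι] [Finite σ] {S : ι → Set (σ → k)}
    (hS : ∀ j, (S j).Nonempty) : dim (blockProduct S) = ∑ j, dim (S j) := by
  choose n g hg using fun j => exists_isNoetherNormalization (hS j)
  rw [(isNoetherNormalization_blockProduct hg).dim_eq]
  simp [(hg _).dim_eq]

lemma dim_eq_of_dim_blockProduct_eq [Infinite k] [Finite ι] [Finite σ] {S V : ι → Set (σ → k)}
    (hS : ∀ j, (S j).Nonempty) (hSV : ∀ j, S j ⊆ V j)
    (h : dim (blockProduct S) = dim (blockProduct V)) (j : ι) : dim (S j) = dim (V j) := by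
  have := Fintype.ofFinite ι
  have hV : ∀ j, (V j).Nonempty := fun j => (hS j).mono (hSV j)
  have hle : ∀ j, dim (S j) ≤ dim (V j) := fun j => dim_mono (hSV j)
  rw [dim_blockProduct hS, dim_blockProduct hV] at h
  choose s hs using fun j => exists_dim_eq_natCast (hS j)
  choose v hv using fun j => exists_dim_eq_natCast (hV j)
  simp only [hs, hv] at h hle ⊢
  norm_cast at h hle ⊢
  exact (Finset.sum_eq_sum_iff_of_le fun j _ => hle j).1 h j (Finset.mem_univ j)

end BlockProduct

section BaseChange

variable {k K σ τ : Type*} [Field k] [Field K] [Algebra k K]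

/-- The polynomial over `k` obtained by applying a `k`-linear functional of an extension field to
every coefficient. -/
def mapCoeff (φ : Module.Dual k K) (p : MvPolynomial σ K) : MvPolynomial σ k :=
  ∑ m ∈ p.support, monomial m (φ (coeff m p))

lemma coeff_mapCoeff (φ : Module.Dual k K) (p : MvPolynomial σ K) (m : σ →₀ ℕ) :
    coeff m (mapCoeff φ p) = φ (coeff m p) := by
  classical
  simp +contextual [mapCoeff, coeff_sum, coeff_monomial]

lemma eval_mapCoeff (φ : Module.Dual k K) (p : MvPolynomial σ K) (a : σ → k) :
    eval a (mapCoeff φ p) = φ (eval (fun i => algebraMap k K (a i)) p) := by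
  simp only [mapCoeff, map_sum, eval_monomial, eval_eq _ p]
  refine Finset.sum_congr rfl fun m _ => ?_
  have hsmul : coeff m p * ∏ i ∈ m.support, algebraMap k K (a i) ^ m i =
      (m.prod fun i e => a i ^ e) • coeff m p := by
    simp [Algebra.smul_def, Finsupp.prod, mul_comm]
  rw [hsmul, map_smul, smul_eq_mul, mul_comm]

lemma eq_zero_of_forall_mapCoeff_eq_zero {p : MvPolynomial σ K}
    (hp : ∀ φ : Module.Dual k K, mapCoeff φ p = 0) : p = 0 := by
  ext m
  refine (Module.forall_dual_apply_eq_zero_iff k _).1 fun φ => ?_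
  rw [← coeff_mapCoeff, hp, coeff_zero]

variable (k) in
/-- The points of `S ⊆ K^σ` with coordinates in the subfield `k`, as a subset of `k^σ`. For
`k = ℝ` and `K = ℂ` this is `realPoints S`. -/
def rationalPoints (S : Set (σ → K)) : Set (σ → k) :=
  {a | (fun i => algebraMap k K (a i)) ∈ S}

lemma IsAlgebraicSet.rationalPoints [Finite σ] {S : Set (σ → K)} (hS : IsAlgebraicSet S) :
    IsAlgebraicSet (rationalPoints k S) := by
  obtain ⟨P, rfl⟩ := hS
  convert isAlgebraicSet_setOf_forall_mem
    {q | ∃ p ∈ P, ∃ φ : Module.Dual k K, mapCoeff φ p = q} using 1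
  ext a
  constructor
  · rintro h _ ⟨p, hp, φ, rfl⟩
    rw [eval_mapCoeff, h p hp, map_zero]
  · intro h p hp
    refine (Module.forall_dual_apply_eq_zero_iff k _).1 fun φ => ?_
    rw [← eval_mapCoeff]
    exact h _ ⟨p, hp, φ, rfl⟩

lemma IsNoetherNormalization.baseChange {S : Set (σ → k)} {g : τ → MvPolynomial σ k}
    (hg : IsNoetherNormalization S g) :
    IsNoetherNormalization ((fun a i => algebraMap k K (a i)) '' S)
      fun t => map (algebraMap k K) (g t) := by
  have heval : ∀ (a : σ → k) (p : MvPolynomial σ k),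
      eval (fun i => algebraMap k K (a i)) (map (algebraMap k K) p) = algebraMap k K (eval a p) :=
    fun a p => (map_eval _ a p).symm
  constructor
  · intro F hF
    refine eq_zero_of_forall_mapCoeff_eq_zero (k := k) fun φ =>
      hg.eq_zero_of_forall_mem _ fun a ha => ?_
    have := hF _ ⟨a, ha, rfl⟩
    simp only [heval] at this
    rw [eval_mapCoeff, this, map_zero]
  · intro i
    obtain ⟨r, hr, hr0⟩ := hg.exists_monic i
    refine ⟨r.map (map (algebraMap k K)), hr.map _, ?_⟩
    rintro _ ⟨a, ha, rfl⟩
    have hcomp : (eval fun t => eval (fun i => algebraMap k K (a i))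
        (map (algebraMap k K) (g t))).comp (map (algebraMap k K)) =
        (algebraMap k K).comp (eval fun t => eval a (g t)) := by
      ext <;> simp [heval]
    rw [Polynomial.eval₂_map, hcomp, ← Polynomial.hom_eval₂, hr0 a ha, map_zero]

lemma dim_rationalPoints_le [Finite σ] (S : Set (σ → K)) : dim (rationalPoints k S) ≤ dim S := by
  rcases (rationalPoints k S).eq_empty_or_nonempty with hempty | hne
  · simp [hempty, dim_empty]
  · obtain ⟨n, g, hg⟩ := exists_isNoetherNormalization hne
    rw [hg.dim_eq, ← (hg.baseChange (K := K)).dim_eq]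
    exact dim_mono (Set.image_subset_iff.2 fun a ha => ha)

end BaseChange

section Cone

variable {K τ : Type*} [Field K]

/-- A linear functional on `K^τ` as a polynomial. -/
def linearForm [Fintype τ] (ℓ : Module.Dual K (τ → K)) : MvPolynomial τ K :=
  open Classical in ∑ i, C (ℓ (Pi.single i 1)) * X i

lemma eval_linearForm [Fintype τ] (ℓ : Module.Dual K (τ → K)) (x : τ → K) :
    eval x (linearForm ℓ) = ℓ x := by
  classical
  simp only [linearForm, map_sum, map_mul, eval_C, eval_X]
  conv_rhs => rw [pi_eq_sum_univ' x, map_sum]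
  exact Finset.sum_congr rfl fun i _ => by rw [map_smul, smul_eq_mul, mul_comm]

lemma isHomogeneous_linearForm [Fintype τ] (ℓ : Module.Dual K (τ → K)) :
    (linearForm ℓ).IsHomogeneous 1 :=
  IsHomogeneous.sum _ _ _ fun i _ => isHomogeneous_C_mul_X _ i

lemma eval_smul_of_isHomogeneous {R : Type*} [CommSemiring R] {p : MvPolynomial τ R} {n : ℕ}
    (hp : p.IsHomogeneous n) (t : R) (x : τ → R) : eval (t • x) p = t ^ n * eval x p := by
  simp only [eval_eq, Finset.mul_sum]
  refine Finset.sum_congr rfl fun m hm => ?_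
  rw [← hp (mem_support_iff.1 hm)]
  simp [Finsupp.weight_apply, Finsupp.sum, mul_pow, Finset.prod_mul_distrib,
    Finset.prod_pow_eq_pow_sum, mul_left_comm]

namespace IsHomogeneousAlgebraicSet

variable {W : Set (τ → K)}

lemma smul_mem (hW : IsHomogeneousAlgebraicSet W) {x : τ → K} (hx : x ∈ W) (t : K) :
    t • x ∈ W := by
  obtain ⟨P, hP, rfl⟩ := hW
  intro p hp
  obtain ⟨n, hn⟩ := hP p hp
  rw [eval_smul_of_isHomogeneous hn, hx p hp, mul_zero]

lemma inter_ker [Finite τ] (hW : IsHomogeneousAlgebraicSet W) (ℓ : Module.Dual K (τ → K)) :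
    IsHomogeneousAlgebraicSet (W ∩ {x | ℓ x = 0}) := by
  classical
  have := Fintype.ofFinite τ
  obtain ⟨P, hP, rfl⟩ := hW
  refine ⟨insert (linearForm ℓ) P, ?_, ?_⟩
  · simpa using ⟨⟨1, isHomogeneous_linearForm ℓ⟩, hP⟩
  · ext x
    simp [eval_linearForm, and_comm]

end IsHomogeneousAlgebraicSet

lemma dim_range_smul [Infinite K] {x : τ → K} (hx : x ≠ 0) :
    dim (Set.range fun t : K => t • x) = 1 := by
  obtain ⟨i, hi : x i ≠ 0⟩ := Function.ne_iff.1 hx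
  have hX : IsNoetherNormalization (Set.range fun t : K => t • x) fun _ : Unit => X i := by
    constructor
    · intro F hF
      refine MvPolynomial.funext fun y => ?_
      simpa [hi] using hF _ ⟨y () / x i, rfl⟩
    · intro j
      refine ⟨Polynomial.X - Polynomial.C (C (x j / x i) * X ()), Polynomial.monic_X_sub_C _, ?_⟩
      rintro _ ⟨t, rfl⟩
      have hcoord : t * x j - x j / x i * (t * x i) = 0 := by field_simp; ring
      simpa using hcoord
  simpa using hX.dim_eq

lemma IsHomogeneousAlgebraicSet.eq_zero_of_dim_le_zero [Infinite K] {W : Set (τ → K)}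
    (hW : IsHomogeneousAlgebraicSet W) (hdim : dim W ≤ 0) {x : τ → K} (hx : x ∈ W) : x = 0 := by
  by_contra hx0
  have hline : dim (Set.range fun t : K => t • x) ≤ dim W :=
    dim_mono (Set.range_subset_iff.2 (hW.smul_mem hx))
  rw [dim_range_smul hx0] at hline
  exact absurd (hline.trans hdim) (by norm_num)

end Cone

section Elimination

section Nakayama

attribute [local instance] MvPolynomial.gradedAlgebra

variable {R τ : Type*} [CommRing R] {F : Set (MvPolynomial τ R)}

lemma homogeneousSubmodule_le_span_sup_smul (hF : ∀ p ∈ F, ∃ n, p.IsHomogeneous n) {𝔪 : Ideal R}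
    {N : ℕ} (hN : idealOfVars τ R ^ N ≤ Ideal.span F ⊔ 𝔪.map C) :
    homogeneousSubmodule τ R N ≤
      (Ideal.span F).restrictScalars R ⊔ 𝔪 • homogeneousSubmodule τ R N := by
  intro p hp
  have hpN : p ∈ idealOfVars τ R ^ N := by
    rw [mem_pow_idealOfVars_iff]
    intro m hm
    rw [Finsupp.degree_eq_weight_one]
    exact (hp (mem_support_iff.1 hm)).ge
  obtain ⟨u, hu, v, hv, rfl⟩ := Submodule.mem_sup.1 (hN hpN)
  have hcomp : homogeneousComponent N (u + v) = u + v := by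
    rw [homogeneousComponent_of_mem hp, if_pos rfl]
  rw [← hcomp, map_add]
  refine Submodule.add_mem_sup
    (homogeneousComponent_mem_of_mem (Ideal.homogeneous_span _ F fun q hq => hF q hq) hu N) ?_
  rw [homogeneousComponent_apply]
  refine Submodule.sum_mem _ fun m hm => ?_
  rw [← mul_one (coeff m v), ← smul_eq_mul, ← smul_monomial]
  refine Submodule.smul_mem_smul (mem_map_C_iff.1 hv m) ?_
  exact isHomogeneous_monomial _ (Finset.mem_filter.1 hm).2

lemma exists_smul_mem_span_of_isHomogeneous [Finite τ] (hF : ∀ p ∈ F, ∃ n, p.IsHomogeneous n)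
    {𝔪 : Ideal R} {N : ℕ} (hN : idealOfVars τ R ^ N ≤ Ideal.span F ⊔ 𝔪.map C) :
    ∃ r : R, r - 1 ∈ 𝔪 ∧ ∀ p : MvPolynomial τ R, p.IsHomogeneous N → r • p ∈ Ideal.span F := by
  obtain ⟨r, hr, hle⟩ := Submodule.exists_sub_one_mem_and_smul_le_of_fg_of_le_sup
    (homogeneousSubmodule_fg τ R N) le_rfl (homogeneousSubmodule_le_span_sup_smul hF hN)
  exact ⟨r, hr, fun p hp => hle (Submodule.smul_mem_pointwise_smul p r _ hp)⟩

end Nakayama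

variable {K τ : Type*} [Field K] [IsAlgClosed K] [Finite τ]

lemma exists_idealOfVars_pow_le_span {F : Set (MvPolynomial τ K)}
    (hF : ∀ x, (∀ p ∈ F, eval x p = 0) → x = 0) :
    ∃ N, idealOfVars τ K ^ N ≤ Ideal.span F := by
  refine Ideal.exists_pow_le_of_le_radical_of_fg ?_ (idealOfVars_fg τ K)
  rw [← vanishingIdeal_zeroLocus_eq_radical (K := K), idealOfVars, Ideal.span_le]
  rintro _ ⟨i, rfl⟩ x hx
  rw [zeroLocus_span] at hx
  simp [hF x hx]

-- By Nakayama, a power of the variables that vanishes modulo `F` over the residue field of `φ₀`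
-- already does so after inverting a single `r` with `φ₀ r ≠ 0`.
lemma exists_forall_eq_zero_of_map_ne_zero {R : Type*} [CommRing R] {F : Set (MvPolynomial τ R)}
    (hF : ∀ p ∈ F, ∃ n, p.IsHomogeneous n) {φ₀ : R →+* K} (hφ₀ : Function.Surjective φ₀)
    (hzero : ∀ x, (∀ p ∈ F, eval₂ φ₀ x p = 0) → x = 0) :
    ∃ r, φ₀ r ≠ 0 ∧
      ∀ φ : R →+* K, φ r ≠ 0 → ∀ x, (∀ p ∈ F, eval₂ φ x p = 0) → x = 0 := by
  obtain ⟨N, hN⟩ := exists_idealOfVars_pow_le_span (F := map φ₀ '' F) fun x hx =>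
    hzero x fun p hp => by simpa [eval_map] using hx _ ⟨p, hp, rfl⟩
  have hNR : idealOfVars τ R ^ N ≤ Ideal.span F ⊔ (RingHom.ker φ₀).map C := by
    rw [← ker_map, ← Ideal.comap_map_of_surjective' _ (map_surjective φ₀ hφ₀),
      ← Ideal.map_le_iff_le_comap, Ideal.map_pow, Ideal.map_span, Ideal.map_span]
    simpa [← Set.range_comp, Function.comp_def] using hN
  obtain ⟨r, hr, hrF⟩ := exists_smul_mem_span_of_isHomogeneous hF hNR
  have hr1 : φ₀ r = 1 := by simpa [sub_eq_zero, RingHom.mem_ker] using hr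
  refine ⟨r, by simp [hr1], fun φ hφ x hx => funext fun i => ?_⟩
  have hker : Ideal.span F ≤ RingHom.ker (eval₂Hom φ x) := Ideal.span_le.2 hx
  have hpow : φ r * x i ^ N = 0 := by
    simpa [smul_eq_C_mul] using hker (hrF (X i ^ N) (isHomogeneous_X_pow i N))
  exact eq_zero_of_pow_eq_zero ((mul_eq_zero_iff_left hφ).1 hpow)

end Elimination

section Sampling

variable {K ι σ τ : Type*} [Field K]

/-- The linear functionals `L(a_j, ·)` given by the blocks `a_j` of `A` have no common zero on `W`
except possibly `0`; in the notation of `sample` this says that `L_A(x) = 0` implies `x = 0` on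
`W`. -/
def IsZeroDetecting (L : (σ → K) →ₗ[K] (τ → K) →ₗ[K] K) (W : Set (τ → K)) (A : ι × σ → K) : Prop :=
  ∀ x ∈ W, (∀ j, L (fun i => A (j, i)) x = 0) → x = 0

/-- The linear form `L(a_j, x)` in `x` whose coefficients are polynomials in the entries of the
indeterminate family `A = (a_j)`. -/
def genericForm [Fintype σ] [Fintype τ] (L : (σ → K) →ₗ[K] (τ → K) →ₗ[K] K) (j : ι) :
    MvPolynomial τ (MvPolynomial (ι × σ) K) :=
  open Classical in ∑ i, C (X (j, i)) * map C (linearForm (L (Pi.single i 1)))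

lemma isHomogeneous_genericForm [Fintype σ] [Fintype τ] (L : (σ → K) →ₗ[K] (τ → K) →ₗ[K] K)
    (j : ι) : (genericForm L j).IsHomogeneous 1 :=
  IsHomogeneous.sum _ _ _ fun _ _ => ((isHomogeneous_linearForm _).map _).C_mul _

lemma eval₂_eval_map_C (A : σ → K) (x : τ → K) (p : MvPolynomial τ K) :
    eval₂ (eval A) x (map C p) = eval x p := by
  have hcomp : (eval A).comp C = RingHom.id K := by ext; simp
  rw [eval₂_map, hcomp]
  rfl

lemma eval₂_genericForm [Fintype σ] [Fintype τ] (L : (σ → K) →ₗ[K] (τ → K) →ₗ[K] K) (j : ι)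
    (A : ι × σ → K) (x : τ → K) :
    eval₂ (eval A) x (genericForm L j) = L (fun i => A (j, i)) x := by
  classical
  conv_rhs => rw [pi_eq_sum_univ' fun i => A (j, i)]
  simp [-eval₂_map, genericForm, eval₂_sum, eval₂_eval_map_C, eval_linearForm]

variable [IsAlgClosed K] [Finite σ] [Finite τ] (L : (σ → K) →ₗ[K] (τ → K) →ₗ[K] K)
  {W : Set (τ → K)}

lemma exists_eval_ne_zero_forall_isZeroDetecting (hW : IsHomogeneousAlgebraicSet W)
    {A₀ : ι × σ → K} (hA₀ : IsZeroDetecting L W A₀) :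
    ∃ f : MvPolynomial (ι × σ) K, eval A₀ f ≠ 0 ∧ ∀ A, eval A f ≠ 0 → IsZeroDetecting L W A := by
  have := Fintype.ofFinite σ
  have := Fintype.ofFinite τ
  obtain ⟨P, hP, rfl⟩ := hW
  let F : Set (MvPolynomial τ (MvPolynomial (ι × σ) K)) :=
    map C '' P ∪ Set.range (genericForm L)
  have hF : ∀ p ∈ F, ∃ n, p.IsHomogeneous n := by
    rintro _ (⟨p, hp, rfl⟩ | ⟨j, rfl⟩)
    · exact (hP p hp).imp fun n hn => hn.map _
    · exact ⟨1, isHomogeneous_genericForm L j⟩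
  have hFzero : ∀ A x, (∀ p ∈ F, eval₂ (eval A) x p = 0) ↔
      (∀ p ∈ P, eval x p = 0) ∧ ∀ j, L (fun i => A (j, i)) x = 0 := by
    simp [-eval₂_map, F, or_imp, forall_and, eval₂_eval_map_C, eval₂_genericForm]
  obtain ⟨f, hfA₀, hf⟩ := exists_forall_eq_zero_of_map_ne_zero hF
    (φ₀ := eval A₀) (fun c => ⟨C c, eval_C c⟩) fun x hx =>
      hA₀ x ((hFzero A₀ x).1 hx).1 ((hFzero A₀ x).1 hx).2
  exact ⟨f, hfA₀, fun A hA x hx hLx => hf (eval A) hA x ((hFzero A x).2 ⟨hx, hLx⟩)⟩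

variable {L}

lemma exists_dim_inter_ker_le (hW : IsAlgebraicSet W) {n : ℕ} (hn : dim W ≤ n + 1)
    {S : Set (σ → K)} (hS : (vanishingIdeal K S).IsPrime)
    (hL : ∀ x ∈ W, x ≠ 0 → ∃ a ∈ S, L a x ≠ 0) :
    ∃ a ∈ S, dim (W ∩ {x | L a x = 0}) ≤ n := by
  have := Fintype.ofFinite σ
  have := Fintype.ofFinite τ
  obtain ⟨N, D, hD, rfl⟩ := hW.exists_eq_iUnion_isPrime
  have hpoint : ∀ i : {i // ¬ D i ⊆ {0}}, ∃ x ∈ D i, x ≠ 0 := fun i => Set.not_subset.1 i.2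
  choose x hxD hx0 using hpoint
  obtain ⟨a, haS, hax⟩ := exists_mem_forall_eval_ne_zero hS
    (q := fun i => linearForm (L.flip (x i))) fun i => by
      obtain ⟨a, ha, hax⟩ := hL (x i) (Set.mem_iUnion_of_mem _ (hxD i)) (hx0 i)
      exact notMem_vanishingIdeal_iff.2 ⟨a, ha, by rwa [eval_linearForm]⟩
  refine ⟨a, haS, ?_⟩
  rw [Set.iUnion_inter, dim_iUnion]
  refine iSup_le fun i => ?_
  by_cases hi : D i ⊆ {0}
  · calc dim (D i ∩ {x | L a x = 0}) ≤ dim {(0 : τ → K)} :=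
          dim_mono (Set.inter_subset_left.trans hi)
      _ = 0 := dim_singleton 0
      _ ≤ n := by exact_mod_cast n.zero_le
  · have hlt : dim (D i ∩ {x | L a x = 0}) < dim (D i) := by
      refine dim_lt_of_mem_vanishingIdeal (hD i) Set.inter_subset_left (f := linearForm (L a))
        (fun y hy => ?_) (notMem_vanishingIdeal_iff.2 ⟨x ⟨i, hi⟩, hxD ⟨i, hi⟩, ?_⟩)
      · rw [aeval_eq_eval, eval_linearForm]
        exact hy.2
      · simpa only [eval_linearForm, LinearMap.flip_apply] using hax ⟨i, hi⟩
    exact ENat.WithBot.lt_add_one_iff.1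
      (hlt.trans_le ((dim_mono (Set.subset_iUnion D i)).trans hn))

lemma exists_mem_blockProduct_isZeroDetecting [Fintype ι] (hW : IsHomogeneousAlgebraicSet W)
    (hdim : dim W ≤ Fintype.card ι) {S : ι → Set (σ → K)}
    (hS : ∀ j, (vanishingIdeal K (S j)).IsPrime)
    (hL : ∀ j, ∀ x ∈ W, x ≠ 0 → ∃ a ∈ S j, L a x ≠ 0) :
    ∃ A ∈ blockProduct S, IsZeroDetecting L W A := by
  classical
  suffices h : ∀ (s : Finset ι) (W : Set (τ → K)), IsHomogeneousAlgebraicSet W →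
      dim W ≤ s.card → (∀ j, ∀ x ∈ W, x ≠ 0 → ∃ a ∈ S j, L a x ≠ 0) →
      ∃ a : ι → σ → K, (∀ j, a j ∈ S j) ∧ ∀ x ∈ W, (∀ j ∈ s, L (a j) x = 0) → x = 0 by
    obtain ⟨a, ha, hzero⟩ := h Finset.univ W hW hdim hL
    exact ⟨fun p => a p.1 p.2, ha, fun x hx hax => hzero x hx fun j _ => hax j⟩
  intro s
  induction s using Finset.induction_on with
  | empty =>
    intro W hW hdim _
    choose a ha using fun j => nonempty_of_isPrime_vanishingIdeal (hS j)
    exact ⟨a, ha, fun x hx _ => hW.eq_zero_of_dim_le_zero (by simpa using hdim) hx⟩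
  | insert j s hj ih =>
    intro W hW hdim hL
    rw [Finset.card_insert_of_notMem hj] at hdim
    obtain ⟨b, hb, hdimb⟩ := exists_dim_inter_ker_le hW.isAlgebraicSet (by simpa using hdim) (hS j)
      (hL j)
    obtain ⟨a, ha, hzero⟩ := ih _ (hW.inter_ker (L b)) hdimb fun j x hx => hL j x hx.1
    refine ⟨Function.update a j b, ?_, fun x hx hax => ?_⟩
    · exact (Function.forall_update_iff a fun j y => y ∈ S j).2 ⟨hb, fun j _ => ha j⟩
    · refine hzero x ⟨hx, by simpa using hax j (Finset.mem_insert_self j s)⟩ fun j' hj' => ?_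
      have hne : j' ≠ j := fun h => hj (h ▸ hj')
      simpa [hne] using hax j' (Finset.mem_insert_of_mem hj')

lemma exists_notMem_vanishingIdeal_forall_isZeroDetecting [Fintype ι]
    (hW : IsHomogeneousAlgebraicSet W) (hdim : dim W ≤ Fintype.card ι) {S : ι → Set (σ → K)}
    (hS : ∀ j, (vanishingIdeal K (S j)).IsPrime)
    (hL : ∀ j, ∀ x ∈ W, x ≠ 0 → ∃ a ∈ S j, L a x ≠ 0) :
    ∃ f ∉ vanishingIdeal K (blockProduct S), ∀ A, eval A f ≠ 0 → IsZeroDetecting L W A := by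
  obtain ⟨A, hAS, hA⟩ := exists_mem_blockProduct_isZeroDetecting hW hdim hS hL
  obtain ⟨f, hfA, hf⟩ := exists_eval_ne_zero_forall_isZeroDetecting L hW hA
  exact ⟨f, notMem_vanishingIdeal_iff.2 ⟨A, hAS, hfA⟩, hf⟩

end Sampling

section Exceptional

variable {K ι σ τ : Type*} [Field K] {L : (σ → K) →ₗ[K] (τ → K) →ₗ[K] K} {W : Set (τ → K)}

/-- The common zero locus of the polynomials `f` in the entries of `A` such that `f(A) ≠ 0` forces
`A` to be zero detecting. -/
def exceptionalSet (L : (σ → K) →ₗ[K] (τ → K) →ₗ[K] K) (W : Set (τ → K)) : Set (ι × σ → K) :=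
  {A | ∀ f ∈ {f | ∀ B : ι × σ → K, eval B f ≠ 0 → IsZeroDetecting L W B}, eval A f = 0}

lemma isAlgebraicSet_exceptionalSet [Finite ι] [Finite σ]
    (L : (σ → K) →ₗ[K] (τ → K) →ₗ[K] K) (W : Set (τ → K)) :
    IsAlgebraicSet (exceptionalSet L W : Set (ι × σ → K)) :=
  isAlgebraicSet_setOf_forall_mem _

lemma isZeroDetecting_of_notMem_exceptionalSet {A : ι × σ → K} (hA : A ∉ exceptionalSet L W) :
    IsZeroDetecting L W A := by
  by_contra h
  exact hA fun f hf => by_contra fun hfA => h (hf A hfA)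

variable [IsAlgClosed K] [Fintype ι] [Finite σ] [Finite τ] {V : ι → Set (σ → K)}

-- Admissibility is only inherited by the irreducible pieces of full dimension; pieces of smaller
-- dimension may lie in the exceptional set.
lemma dim_blockProduct_inter_exceptionalSet_lt_of_isPrime (hW : IsHomogeneousAlgebraicSet W)
    (hdim : dim W ≤ Fintype.card ι)
    (hadm : ∀ j, ∀ x ∈ W, x ≠ 0 → dim (V j ∩ {a | L a x = 0}) < dim (V j))
    {S : ι → Set (σ → K)} (hS : ∀ j, (vanishingIdeal K (S j)).IsPrime) (hSV : ∀ j, S j ⊆ V j) :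
    dim (blockProduct S ∩ exceptionalSet L W) < dim (blockProduct V) := by
  rcases (dim_mono (blockProduct_mono hSV)).lt_or_eq with hlt | heq
  · exact (dim_mono Set.inter_subset_left).trans_lt hlt
  have hdimS : ∀ j, dim (S j) = dim (V j) :=
    dim_eq_of_dim_blockProduct_eq (fun j => nonempty_of_isPrime_vanishingIdeal (hS j)) hSV heq
  have hL : ∀ j, ∀ x ∈ W, x ≠ 0 → ∃ a ∈ S j, L a x ≠ 0 := by
    intro j x hx hx0
    by_contra! hzero
    refine (hadm j x hx hx0).not_ge ?_
    rw [← hdimS j]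
    exact dim_mono fun a ha => ⟨hSV j ha, hzero a ha⟩
  obtain ⟨f, hfS, hf⟩ := exists_notMem_vanishingIdeal_forall_isZeroDetecting hW hdim hS hL
  rw [← heq]
  exact dim_lt_of_mem_vanishingIdeal (isPrime_vanishingIdeal_blockProduct hS)
    Set.inter_subset_left (fun A hA => hA.2 f hf) hfS

lemma dim_blockProduct_inter_exceptionalSet_lt (hW : IsHomogeneousAlgebraicSet W)
    (hdim : dim W ≤ Fintype.card ι) (hV : ∀ j, IsAlgebraicSet (V j))
    (hVne : ∀ j, (V j).Nonempty)
    (hadm : ∀ j, ∀ x ∈ W, x ≠ 0 → dim (V j ∩ {a | L a x = 0}) < dim (V j)) :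
    dim (blockProduct V ∩ exceptionalSet L W) < dim (blockProduct V) := by
  have hbot : ⊥ < dim (blockProduct V) := by
    choose a ha using hVne
    obtain ⟨n, hn⟩ := exists_dim_eq_natCast (S := blockProduct V) ⟨fun p => a p.1 p.2, ha⟩
    rw [hn]
    exact WithBot.bot_lt_coe _
  choose N D hD hVD using fun j => (hV j).exists_eq_iUnion_isPrime
  have hcover : blockProduct V ∩ exceptionalSet L W =
      ⋃ c : ∀ j, Fin (N j), (blockProduct fun j => D j (c j)) ∩ exceptionalSet L W := by
    rw [← Set.iUnion_inter, ← blockProduct_iUnion]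
    simp only [← hVD]
  rw [hcover]
  exact dim_iUnion_lt hbot fun c =>
    dim_blockProduct_inter_exceptionalSet_lt_of_isPrime hW hdim hadm (fun j => hD j (c j))
      fun j => (Set.subset_iUnion (D j) (c j)).trans (hVD j).ge

end Exceptional

end OptimalSampling

end

open OptimalSampling in
theorem mainTheorem2_general {k K ι σ τ : Type*} [Field k] [Field K] [Algebra k K] [IsAlgClosed K]
    [Fintype ι] [Finite σ] [Finite τ] (L : (σ → K) →ₗ[K] (τ → K) →ₗ[K] K)
    {W : Set (τ → K)} (hW : IsHomogeneousAlgebraicSet W)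
    {V : ι → Set (σ → K)} (hV : ∀ j, IsAlgebraicSet (V j)) (hVne : ∀ j, (V j).Nonempty)
    (hadm : ∀ j, ∀ x ∈ W, x ≠ 0 → dim (V j ∩ {a | L a x = 0}) < dim (V j))
    (hdim : dim W ≤ Fintype.card ι) :
    ∃ Z : Set (ι × σ → k), IsAlgebraicSet Z ∧ Z ⊆ rationalPoints k (blockProduct V) ∧
      dim Z < dim (blockProduct V) ∧
      ∀ A ∈ rationalPoints k (blockProduct V) \ Z,
        IsZeroDetecting L W fun p => algebraMap k K (A p) := by
  refine ⟨rationalPoints k (blockProduct V ∩ exceptionalSet L W), ?_, fun A hA => hA.1, ?_, ?_⟩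
  · exact ((isAlgebraicSet_blockProduct hV).inter
      (isAlgebraicSet_exceptionalSet L W)).rationalPoints
  · exact (dim_rationalPoints_le _).trans_lt
      (dim_blockProduct_inter_exceptionalSet_lt hW hdim hV hVne hadm)
  · rintro A ⟨hAV, hAZ⟩
    exact isZeroDetecting_of_notMem_exceptionalSet fun hA => hAZ ⟨hAV, hA⟩

theorem mainTheorem2 {d m : ℕ}
    (L : (Fin d → ℂ) →ₗ[ℂ] (Fin d → ℂ) →ₗ[ℂ] ℂ)
    (W : Set (Fin d → ℂ)) (hW : OptimalSampling.IsHomogeneousAlgebraicSet W)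
    (V : Fin m → Set (Fin d → ℂ))
    (hV : ∀ j, OptimalSampling.IsAlgebraicSet (V j))
    (hVne : ∀ j, (V j).Nonempty)
    (hadm : ∀ j, OptimalSampling.IsAdmissible (V j)
      {ℓ | ∃ x ∈ W \ {0}, ℓ = L.flip x})
    (hreal : OptimalSampling.dim
        (OptimalSampling.realPoints (OptimalSampling.productSet V)) =
      OptimalSampling.dim (OptimalSampling.productSet V))
    (hm : OptimalSampling.dim W ≤ (m : WithBot ℕ∞)) :
    ∃ Z : Set (Fin m × Fin d → ℝ),
      OptimalSampling.IsAlgebraicSet Z ∧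
      Z ⊆ OptimalSampling.realPoints (OptimalSampling.productSet V) ∧
      OptimalSampling.dim Z <
        OptimalSampling.dim (OptimalSampling.realPoints (OptimalSampling.productSet V)) ∧
      ∀ A ∈ OptimalSampling.realPoints (OptimalSampling.productSet V) \ Z,
        ∀ x ∈ W, OptimalSampling.sample L (fun p => (A p : ℂ)) x = 0 → x = 0 := by
  obtain ⟨Z, hZ, hZV, hZdim, hdetect⟩ := mainTheorem2_general (k := ℝ) L hW hV hVne
    (fun j x hx hx0 => hadm j (L.flip x) ⟨x, ⟨hx, hx0⟩, rfl⟩) (by simpa using hm)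
  exact ⟨Z, hZ, hZV, hreal ▸ hZdim, fun A hA x hx h => hdetect A hA x hx (congrFun h)⟩
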